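/- Fix structural constants $1\le p<\infty$, $D\ge 1$, $C\ge 1$ and a scale $r_0\in(0,\infty]$. There exist constants $C_0\ge 1$ and $\Delta>0$, depending only on $(p,D,C,r_0)$, such that the following holds for every proper metric space $(X,d)$ with a Radon measure $\mu$. Suppose that $\mu$ is $D$-doubling up to scale $r_0$, i.e. $0<\mu(B(x,2r))\le D\,\mu(B(x,r))$ for all $x\in X$ and $0<r<r_0$, and that $X$ satisfies a $(1,p)$-Poincaré inequality at scale $r_0$ with constant $C$, i.e. for all Lipschitz $f:X\to\mathbb R$, all $x\in X$ and all $0<r<r_0$, with $B=B(x,r)$ and $CB=B(x,Cr)$, $$\frac1{\mu(B)}\int_B|f-f_B|\,d\mu\le C r\Big(\frac1{\mu(CB)}\int_{CB}\mathrm{Lip}[f]^p\,d\mu\Big)^{1/p},$$ where $f_B=\frac1{\mu(B)}\int_B f\,d\mu$ and $\mathrm{Lip}[f](x)=\limsup_{y\to x,\,y\ne x}\frac{|f(x)-f(y)|}{d(x,y)}$ ($0$ at isolated points). Then $X$ is $(C_0,\Delta,p)$-maximally connected at scale $r_0/2$: for all $x,y\in X$ with $r:=d(x,y)\in(0,r_0/2)$,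 every $\tau>0$ and every Borel set $E\subset X$ such that $$\sup_{0<s<C_0r}\frac{\mu(E\cap B(z,s))}{\mu(B(z,s))}<\tau\qquad\text{for } z=x \text{ and } z=y,$$ there are $L>0$ and a $1$-Lipschitz curve $\gamma:[0,L]\to X$ with $\gamma(0)=x$, $\gamma(L)=y$, $\mathrm{Len}(\gamma)\le C_0r$ and $$\int_\gamma 1_E\,ds\le\Delta\,\tau^{1/p}\,r .$$ Here $\int_\gamma f\,ds=\int_0^L f(\gamma(t))\,d_\gamma(t)\,dt$, where $d_\gamma$ is the metric derivative of $\gamma$. For $r_0=\infty$ the conditions are the global ones, and $r_0/2=\infty$. -/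

import Mathlib

open MeasureTheory Set Filter Topology
open scoped ENNReal

noncomputable section

namespace MetricPI

/-- The pointwise (upper) Lipschitz constant `Lip [f](x) = limsup_{y → x, y ≠ x} |f x - f y| / d(x, y)`,
with values in `[0, ∞]`; it is `0` at isolated points. -/
def pointwiseLip {X : Type*} [MetricSpace X] (f : X → ℝ) (x : X) : ℝ≥0∞ :=
  limsup (fun y => edist (f x) (f y) / edist x y) (𝓝[≠] x)

/-- `μ` is `D`-doubling at scale `r₀`: `0 < μ(B(x, 2r)) ≤ D μ(B(x, r))` for all `x` and all
`0 < r < r₀`. The scale `r₀ = ∞` is the global condition. -/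
def DoublingAtScale {X : Type*} [MetricSpace X] [MeasurableSpace X] (μ : Measure X)
    (D : ℝ) (r₀ : ℝ≥0∞) : Prop :=
  ∀ (x : X) (r : ℝ), 0 < r → ENNReal.ofReal r < r₀ →
    0 < μ (Metric.ball x (2 * r)) ∧
      μ (Metric.ball x (2 * r)) ≤ ENNReal.ofReal D * μ (Metric.ball x r)

/-- The `(1, p)`-Poincaré inequality at scale `r₀` with constant `C`, for all Lipschitz functions
and all balls of radius `0 < r < r₀`. The scale `r₀ = ∞` is the global inequality. -/
def PoincareAtScale {X : Type*} [MetricSpace X] [MeasurableSpace X] (μ : Measure X)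
    (p C : ℝ) (r₀ : ℝ≥0∞) : Prop :=
  ∀ f : X → ℝ, (∃ K : NNReal, LipschitzWith K f) →
    ∀ (x : X) (r : ℝ), 0 < r → ENNReal.ofReal r < r₀ →
      ⨍⁻ z in Metric.ball x r, ‖f z - ⨍ w in Metric.ball x r, f w ∂μ‖ₑ ∂μ ≤
        ENNReal.ofReal (C * r) *
          (⨍⁻ z in Metric.ball x (C * r), pointwiseLip f z ^ p ∂μ) ^ (1 / p)

/-- The restricted centered maximal function
`M_s f(x) = sup_{0 < r < s} ⨍_{B(x, r)} f dμ` of a nonnegative function. -/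
def maximalFunction {X : Type*} [MetricSpace X] [MeasurableSpace X] (μ : Measure X)
    (s : ℝ) (f : X → ℝ≥0∞) (x : X) : ℝ≥0∞ :=
  ⨆ r ∈ Ioo (0 : ℝ) s, ⨍⁻ z in Metric.ball x r, f z ∂μ

/-- The metric derivative at `t` of a curve `γ` defined on `[0, L]`. The limit of
`d(γ s, γ t) / |s - t|` as `s → t` in `[0, L]` exists for almost every `t` when `γ` is Lipschitz
there; the upper limit is taken so that the function is defined everywhere. -/
def metricDeriv {X : Type*} [MetricSpace X] (γ : ℝ → X) (L t : ℝ) : ℝ≥0∞ :=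
  limsup (fun s => edist (γ t) (γ s) / edist t s) (𝓝[Icc 0 L \ {t}] t)

/-- The path integral `∫_γ f ds` of a nonnegative function along a curve `γ` on `[0, L]`. -/
def pathIntegral {X : Type*} [MetricSpace X] (γ : ℝ → X) (L : ℝ) (f : X → ℝ≥0∞) : ℝ≥0∞ :=
  ∫⁻ t in Icc 0 L, f (γ t) * metricDeriv γ L t

/-- `X` is `(C, δ, p)`-maximally connected at scale `r₀`. A curve `[0, L] → X` is represented by a
function on `ℝ` of which only the restriction to `[0, L]` matters. -/
def MaxConnectedAtScale {X : Type*} [MetricSpace X] [MeasurableSpace X] (μ : Measure X)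
    (C δ p : ℝ) (r₀ : ℝ≥0∞) : Prop :=
  ∀ x y : X, 0 < dist x y → ENNReal.ofReal (dist x y) < r₀ →
    ∀ τ : ℝ, 0 < τ → ∀ E : Set X, MeasurableSet E →
      maximalFunction μ (C * dist x y) (E.indicator 1) x < ENNReal.ofReal τ →
      maximalFunction μ (C * dist x y) (E.indicator 1) y < ENNReal.ofReal τ →
      ∃ (L : ℝ) (γ : ℝ → X), 0 < L ∧ LipschitzOnWith 1 γ (Icc 0 L) ∧
        γ 0 = x ∧ γ L = y ∧
        eVariationOn γ (Icc 0 L) ≤ ENNReal.ofReal (C * dist x y) ∧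
        pathIntegral γ L (E.indicator 1) ≤ ENNReal.ofReal (δ * τ ^ (1 / p) * dist x y)

end MetricPI

end

/-! Write `r = d(x,y)` and `b = τ^(1/p)`. Apart from `x` and `y`, the set `E` lies in an open set
`U` avoiding both points and of density at most `2τ` around them. Charge curves by the density `1_U
+ b`. If `f(w)` is the least cost of reaching `w` from `x`, then `Lip f ≤ 1_U + b`, so the Poincaré
inequality bounds the mean oscillation of `f` on balls of radius `s` about `x` and `y` by `6Cbs`.
Telescoping over such balls gives `|f(x) - f(y)| ≤ 48 D² C b r`. A curve of cost at most `49 D² C b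
r` therefore exists; the term `b` bounds its length by `49 D² C r`, and the term `1_U` bounds its
time in `U` as required.

Two obstacles make this indirect. Curves might not exist at all, so `f` is built from curves with
jumps of size `δ` and truncated, which makes it finite and Lipschitz
(`exists_lipschitzWith_coarseDist`). And `Lip f` is controlled by the density only where the density
is continuous, so `1_U` is replaced by continuous functions increasing to it. Properness then yields
a genuine curve as `δ → 0` (`exists_curve_of_coarselyJoined`). The analytic half is
`PoincareAtScale.oscillation_le` and `abs_sub_le_of_oscillation_le`. -/

namespace MetricPI

/-! ### Coarse curves and the cost function -/

/-- `x` is joined to `w` with cost `c` by a map `γ` which is `1`-Lipschitz up to the additive error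
`δ`, the cost being measured by the integral of `ρ` in the time variable. -/
def CoarselyJoined {X : Type*} [MetricSpace X] (δ : ℝ) (ρ : X → ℝ) (x w : X) (c : ℝ) : Prop :=
  ∃ (L : ℝ) (γ : ℝ → X), 0 ≤ L ∧ γ 0 = x ∧ (∀ t, L ≤ t → γ t = w) ∧
    (∀ s t, dist (γ s) (γ t) ≤ |s - t| + δ) ∧
    ∫⁻ t in Ico 0 L, ENNReal.ofReal (ρ (γ t)) ≤ ENNReal.ofReal c

theorem CoarselyJoined.refl {X : Type*} [MetricSpace X] {δ : ℝ} (hδ : 0 ≤ δ) (ρ : X → ℝ) (x : X) :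
    CoarselyJoined δ ρ x x 0 :=
  ⟨0, fun _ => x, le_rfl, rfl, fun _ _ => rfl,
    fun s t => by rw [dist_self]; positivity, by simp⟩

/-- Wait at `w` for time `d(w, w')`, then jump. The waiting time compensates the jump, so repeated
extensions do not accumulate the additive error `δ`. -/
theorem CoarselyJoined.extend {X : Type*} [MetricSpace X] {δ : ℝ} {ρ : X → ℝ} {x w w' : X} {c : ℝ}
    (h : CoarselyJoined δ ρ x w c) (hc : 0 ≤ c) (hρ : 0 ≤ ρ w) (hd : dist w w' ≤ δ) :
    CoarselyJoined δ ρ x w' (c + ρ w * dist w w') := by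
  obtain ⟨L, γ, hL, h0, hend, hlip, hint⟩ := h
  have hl : 0 ≤ dist w w' := dist_nonneg
  have key : ∀ s t, s < L + dist w w' → L + dist w w' ≤ t → dist (γ s) w' ≤ |s - t| + δ := by
    intro s t hs ht
    rw [abs_sub_comm, abs_of_nonneg (by linarith)]
    rcases le_total s L with hsL | hsL
    · have h1 := hlip s L
      rw [hend L le_rfl, abs_sub_comm, abs_of_nonneg (by linarith)] at h1
      linarith [dist_triangle (γ s) w w']
    · rw [hend s hsL]
      linarith
  refine ⟨L + dist w w', fun t => if t < L + dist w w' then γ t else w', by positivity, ?_, ?_, ?_,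
    ?_⟩
  · dsimp only
    split_ifs with h
    · exact h0
    · have h1 : L = 0 := by linarith
      have h2 : dist w w' = 0 := by linarith
      rw [← dist_eq_zero.1 h2, ← hend 0 h1.le, h0]
  · intro t ht
    simp [not_lt.2 ht]
  · intro s t
    dsimp only
    split_ifs with hs ht ht
    · exact hlip s t
    · exact key s t hs (not_lt.1 ht)
    · rw [dist_comm, abs_sub_comm]
      exact key t s ht (not_lt.1 hs)
    · rw [dist_self]
      have := abs_nonneg (s - t)
      linarith
  · rw [← Ico_union_Ico_eq_Ico hL (show L ≤ L + dist w w' by linarith)]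
    refine (lintegral_union_le _ _ _).trans ?_
    rw [ENNReal.ofReal_add hc (by positivity)]
    refine add_le_add (le_trans (le_of_eq ?_) hint) (le_of_eq ?_)
    · refine setLIntegral_congr_fun measurableSet_Ico fun t ht => ?_
      have : t < L + dist w w' := by linarith [ht.2]
      simp [this]
    · rw [setLIntegral_congr_fun (g := fun _ => ENNReal.ofReal (ρ w)) measurableSet_Ico
        fun t ht => by simp [ht.2, hend t ht.1]]
      rw [setLIntegral_const, Real.volume_Ico, ← ENNReal.ofReal_mul hρ]
      congr 2
      ring

/-- The least cost of a coarse curve from `x`, truncated at height `M`. -/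
noncomputable def coarseDist {X : Type*} [MetricSpace X] (δ : ℝ) (ρ : X → ℝ) (M : ℝ) (x w : X) : ℝ :=
  sInf (insert M {c | 0 ≤ c ∧ CoarselyJoined δ ρ x w c})

section coarseDist

variable {X : Type*} [MetricSpace X] {δ M : ℝ} {ρ : X → ℝ} {x w w' : X}

theorem bddBelow_costs (hM : 0 ≤ M) :
    BddBelow (insert M {c | 0 ≤ c ∧ CoarselyJoined δ ρ x w c}) := by
  refine ⟨0, ?_⟩
  rintro c (rfl | hc)
  exacts [hM, hc.1]

theorem coarseDist_nonneg (hM : 0 ≤ M) : 0 ≤ coarseDist δ ρ M x w := by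
  refine le_csInf (insert_nonempty _ _) ?_
  rintro c (rfl | hc)
  exacts [hM, hc.1]

theorem coarseDist_le (hM : 0 ≤ M) : coarseDist δ ρ M x w ≤ M :=
  csInf_le (bddBelow_costs hM) (mem_insert _ _)

theorem coarseDist_self (hδ : 0 ≤ δ) (hM : 0 ≤ M) : coarseDist δ ρ M x x = 0 :=
  le_antisymm (csInf_le (bddBelow_costs hM) (Or.inr ⟨le_rfl, CoarselyJoined.refl hδ ρ x⟩))
    (coarseDist_nonneg hM)

theorem exists_coarselyJoined_of_coarseDist_lt {a : ℝ} (ha : a ≤ M)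
    (h : coarseDist δ ρ M x w < a) : CoarselyJoined δ ρ x w a := by
  obtain ⟨c, hc, hca⟩ := exists_lt_of_csInf_lt (insert_nonempty _ _) h
  rcases hc with rfl | ⟨-, L, γ, h1, h2, h3, h4, h5⟩
  · exact absurd hca (not_lt.2 ha)
  · exact ⟨L, γ, h1, h2, h3, h4, h5.trans (ENNReal.ofReal_le_ofReal hca.le)⟩

theorem coarseDist_le_add (hM : 0 ≤ M) (hρ : ∀ z, 0 ≤ ρ z) (hd : dist w w' ≤ δ) :
    coarseDist δ ρ M x w' ≤ coarseDist δ ρ M x w + ρ w * dist w w' := by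
  rw [← sub_le_iff_le_add]
  have h0 : 0 ≤ ρ w * dist w w' := mul_nonneg (hρ w) dist_nonneg
  refine le_csInf (insert_nonempty _ _) ?_
  rintro c (rfl | hc)
  · linarith [coarseDist_le (δ := δ) (ρ := ρ) (x := x) (w := w') hM]
  · rw [sub_le_iff_le_add]
    exact csInf_le (bddBelow_costs hM)
      (Or.inr ⟨add_nonneg hc.1 h0, hc.2.extend hc.1 (hρ w) hd⟩)

theorem abs_coarseDist_sub_le (hM : 0 ≤ M) (hρ : ∀ z, 0 ≤ ρ z) (hd : dist w w' ≤ δ) :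
    |coarseDist δ ρ M x w - coarseDist δ ρ M x w'| ≤ max (ρ w) (ρ w') * dist w w' := by
  have h1 := coarseDist_le_add (x := x) hM hρ hd
  have h2 := coarseDist_le_add (x := x) hM hρ (dist_comm w w' ▸ hd)
  rw [dist_comm w' w] at h2
  have h3 := mul_le_mul_of_nonneg_right (le_max_left (ρ w) (ρ w')) (dist_nonneg (x := w) (y := w'))
  have h4 := mul_le_mul_of_nonneg_right (le_max_right (ρ w) (ρ w')) (dist_nonneg (x := w) (y := w'))
  rw [abs_le]
  constructor <;> linarith

/-- At distances up to `δ` one jump suffices; beyond `δ` the truncation at `M` gives slope at most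
`M / δ`. The constant degenerates as `δ → 0`, which is harmless because the final estimate does not
involve it. -/
theorem exists_lipschitzWith_coarseDist (hδ : 0 < δ) (hM : 0 ≤ M) (hρ : ∀ z, 0 ≤ ρ z) {b : ℝ}
    (hb : ∀ z, ρ z ≤ b) : ∃ K, LipschitzWith K (coarseDist δ ρ M x) := by
  refine ⟨Real.toNNReal (max b (M / δ)), LipschitzWith.of_dist_le_mul fun w w' => ?_⟩
  rw [Real.coe_toNNReal _ (le_max_of_le_right (by positivity)), Real.dist_eq]
  rcases le_total (dist w w') δ with hd | hd
  · refine (abs_coarseDist_sub_le hM hρ hd).trans ?_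
    exact mul_le_mul_of_nonneg_right (le_max_of_le_left (max_le (hb _) (hb _))) dist_nonneg
  · have h1 : |coarseDist δ ρ M x w - coarseDist δ ρ M x w'| ≤ M := by
      rw [abs_le]
      constructor <;> linarith [coarseDist_nonneg (δ := δ) (ρ := ρ) (x := x) (w := w) hM,
        coarseDist_nonneg (δ := δ) (ρ := ρ) (x := x) (w := w') hM,
        coarseDist_le (δ := δ) (ρ := ρ) (x := x) (w := w) hM,
        coarseDist_le (δ := δ) (ρ := ρ) (x := x) (w := w') hM]
    calc _ ≤ M := h1
      _ = M / δ * δ := by field_simp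
      _ ≤ max b (M / δ) * dist w w' := by
        gcongr
        exact le_max_right _ _

/-- A jump between nearby points costs the larger of the two densities, in either direction;
continuity of `ρ` turns this maximum into `ρ w` in the limit. -/
theorem pointwiseLip_coarseDist_le (hδ : 0 < δ) (hM : 0 ≤ M) (hρ : ∀ z, 0 ≤ ρ z)
    (hc : Continuous ρ) (w : X) :
    pointwiseLip (coarseDist δ ρ M x) w ≤ ENNReal.ofReal (ρ w) := by
  refine ENNReal.le_of_forall_pos_le_add fun ε hε _ => ?_
  refine limsup_le_of_le (by isBoundedDefault) ?_
  have h1 : ∀ᶠ y in 𝓝[≠] w, ρ y < ρ w + ε :=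
    (hc.continuousAt.eventually (gt_mem_nhds (by simpa using hε))).filter_mono nhdsWithin_le_nhds
  have h2 : ∀ᶠ y in 𝓝[≠] w, dist y w < δ :=
    mem_nhdsWithin_of_mem_nhds (Metric.ball_mem_nhds w hδ)
  filter_upwards [h1, h2] with y hy1 hy2
  refine ENNReal.div_le_of_le_mul ?_
  rw [edist_dist, edist_dist, ← ENNReal.ofReal_coe_nnreal, ← ENNReal.ofReal_add (hρ w) ε.coe_nonneg,
    ← ENNReal.ofReal_mul (add_nonneg (hρ w) ε.coe_nonneg)]
  refine ENNReal.ofReal_le_ofReal ?_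
  refine (abs_coarseDist_sub_le hM hρ (dist_comm y w ▸ hy2.le)).trans ?_
  gcongr
  exact max_le (by simp) hy1.le

end coarseDist

/-! ### Limits of coarse curves, first passage, length -/

/-- Limits of `δ`-coarse curves as `δ → 0`, along an ultrafilter. -/
theorem exists_uniform_limit_coarse {X : Type*} [MetricSpace X] [ProperSpace X] {x : X}
    {δ : ℕ → ℝ} (hδ : Tendsto δ atTop (𝓝 0)) (hδ1 : ∀ n, δ n ≤ 1) {γ : ℕ → ℝ → X}
    (h0 : ∀ n, γ n 0 = x)
    (hγ : ∀ n s t, dist (γ n s) (γ n t) ≤ |s - t| + δ n) (Λ : ℝ) :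
    ∃ σ : ℝ → X, LipschitzWith 1 σ ∧ σ 0 = x ∧
      (∀ y t, (∀ n, γ n t = y) → σ t = y) ∧
      ∀ ε > 0, ∀ m : ℕ, ∃ n ≥ m, ∀ t ∈ Icc 0 Λ, dist (γ n t) (σ t) ≤ ε := by
  have hF : (hyperfilter ℕ : Filter ℕ) ≤ atTop := Nat.hyperfilter_le_atTop
  -- Each orbit stays in a compact ball, and one ultrafilter gives limits at all times
  -- simultaneously, with no diagonal extraction.
  have hlim : ∀ t, ∃ z, Tendsto (fun n => γ n t) (hyperfilter ℕ) (𝓝 z) := by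
    intro t
    obtain ⟨z, -, hz⟩ := (isCompact_closedBall x (|t| + 1)).ultrafilter_le_nhds
      ((hyperfilter ℕ).map fun n => γ n t) (by
        rw [le_principal_iff, Ultrafilter.coe_map, mem_map]
        refine Filter.univ_mem' fun n => ?_
        have := hγ n t 0
        rw [h0, sub_zero] at this
        exact this.trans (by linarith [hδ1 n]))
    exact ⟨z, hz⟩
  choose σ hσ using hlim
  have hlip : LipschitzWith 1 σ := by
    refine LipschitzWith.of_dist_le_mul fun s t => ?_
    have h1 : Tendsto (fun n => |s - t| + δ n) (hyperfilter ℕ) (𝓝 (|s - t| + 0)) :=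
      tendsto_const_nhds.add (hδ.mono_left hF)
    rw [add_zero] at h1
    simpa [Real.dist_eq] using
      le_of_tendsto_of_tendsto ((hσ s).dist (hσ t)) h1 (Eventually.of_forall fun n => hγ n s t)
  have hconst : ∀ y t, (∀ n, γ n t = y) → σ t = y := by
    intro y t h
    have := hσ t
    simp only [h] at this
    exact tendsto_nhds_unique this tendsto_const_nhds
  refine ⟨σ, hlip, hconst x 0 h0, hconst, fun ε hε m => ?_⟩
  have huni : ∀ᶠ n in (hyperfilter ℕ : Filter ℕ), ∀ t ∈ Icc 0 Λ, dist (γ n t) (σ t) ≤ ε := by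
    refine (isCompact_Icc (a := (0 : ℝ)) (b := Λ)).induction_on
      (p := fun S => ∀ᶠ n in (hyperfilter ℕ : Filter ℕ), ∀ t ∈ S, dist (γ n t) (σ t) ≤ ε)
      (by simp) (fun S T hST h => h.mono fun n hn t ht => hn t (hST ht))
      (fun S T hS hT => ?_) fun t _ => ?_
    · filter_upwards [hS, hT] with n h1 h2 t ht
      exact ht.elim (h1 t) (h2 t)
    -- Four errors of `ε / 4`: the time difference and `δ n` for `γ n`, the convergence at `t`, and
    -- the time difference for `σ`.
    · refine ⟨Metric.ball t (ε / 4), mem_nhdsWithin_of_mem_nhds (Metric.ball_mem_nhds _ (by linarith)),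
        ?_⟩
      have h1 : ∀ᶠ n in (hyperfilter ℕ : Filter ℕ), dist (γ n t) (σ t) < ε / 4 :=
        (hσ t) (Metric.ball_mem_nhds _ (by linarith))
      have h2 : ∀ᶠ n in (hyperfilter ℕ : Filter ℕ), δ n < ε / 4 :=
        (hδ.mono_left hF) (gt_mem_nhds (by linarith))
      filter_upwards [h1, h2] with n h1 h2 s hs
      have h3 := hγ n s t
      have h4 := hlip.dist_le_mul t s
      have h5 : |s - t| < ε / 4 := hs
      rw [dist_comm t s, Real.dist_eq] at h4
      simp only [NNReal.coe_one, one_mul] at h4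
      linarith [dist_triangle4 (γ n s) (γ n t) (σ t) (σ s)]
  obtain ⟨n, hn1, hn2⟩ := (huni.and (hF (eventually_ge_atTop m))).exists
  exact ⟨n, hn2, hn1⟩

/-- A Lipschitz map on an interval joining two distinct points contains a piece which joins them and
meets them only at its endpoints. -/
theorem exists_first_passage {X : Type*} [MetricSpace X] {σ : ℝ → X} (hσ : Continuous σ) {x y : X}
    (hxy : x ≠ y) {Λ : ℝ} (hΛ : 0 ≤ Λ) (h0 : σ 0 = x) (h1 : σ Λ = y) :
    ∃ a b, 0 ≤ a ∧ a < b ∧ b ≤ Λ ∧ σ a = x ∧ σ b = y ∧ ∀ t ∈ Ioo a b, σ t ≠ x ∧ σ t ≠ y := by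
  have hS : IsCompact (Icc 0 Λ ∩ σ ⁻¹' {x}) :=
    isCompact_Icc.inter_right (isClosed_singleton.preimage hσ)
  -- Take the last visit to `x`, then the first visit to `y` after it.
  obtain ⟨a, ⟨haI, hax⟩, ha⟩ := hS.exists_isGreatest ⟨0, ⟨le_rfl, hΛ⟩, h0⟩
  have hT : IsCompact (Icc a Λ ∩ σ ⁻¹' {y}) :=
    isCompact_Icc.inter_right (isClosed_singleton.preimage hσ)
  obtain ⟨b, ⟨hbI, hby⟩, hb⟩ := hT.exists_isLeast ⟨Λ, ⟨haI.2, le_rfl⟩, h1⟩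
  simp only [mem_preimage, mem_singleton_iff] at hax hby
  refine ⟨a, b, haI.1, lt_of_le_of_ne hbI.1 ?_, hbI.2, hax, hby, fun t ht => ⟨fun h => ?_, fun h => ?_⟩⟩
  · rintro rfl
    exact hxy (hax.symm.trans hby)
  · exact absurd (ha ⟨⟨haI.1.trans ht.1.le, ht.2.le.trans hbI.2⟩, h⟩) (not_le.2 ht.1)
  · exact absurd (hb ⟨⟨ht.1.le, ht.2.le.trans hbI.2⟩, h⟩) (not_le.2 ht.2)

theorem metricDeriv_le_one {X : Type*} [MetricSpace X] {γ : ℝ → X} {L t : ℝ}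
    (hγ : LipschitzOnWith 1 γ (Icc 0 L)) (ht : t ∈ Icc 0 L) : metricDeriv γ L t ≤ 1 := by
  refine limsup_le_of_le (by isBoundedDefault) ?_
  filter_upwards [self_mem_nhdsWithin] with s hs
  refine ENNReal.div_le_of_le_mul ?_
  simpa using hγ ht hs.1

theorem eVariationOn_le_of_lipschitzOnWith {X : Type*} [MetricSpace X] {γ : ℝ → X} {L : ℝ}
    (hγ : LipschitzOnWith 1 γ (Icc 0 L)) :
    eVariationOn γ (Icc 0 L) ≤ ENNReal.ofReal L := by
  have h := hγ.comp_eVariationOn_le (g := id) (s := Icc 0 L) (fun _ h => h)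
  have h2 : eVariationOn (id : ℝ → ℝ) (Icc 0 L) ≤ ENNReal.ofReal (id L - id 0) := by
    simp
  simp only [Function.comp_id, ENNReal.coe_one, one_mul, id, sub_zero] at h h2
  exact h.trans h2

/-! ### Continuous approximation of an indicator -/

/-- Lipschitz functions increasing to the indicator function of the open set `U`. -/
noncomputable def cutoff {X : Type*} [MetricSpace X] (U : Set X) (n : ℕ) (z : X) : ℝ :=
  min 1 (n * Metric.infDist z Uᶜ)

section cutoff

variable {X : Type*} [MetricSpace X] {U : Set X}

theorem cutoff_nonneg (n : ℕ) (z : X) : 0 ≤ cutoff U n z :=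
  le_min zero_le_one (mul_nonneg n.cast_nonneg Metric.infDist_nonneg)

theorem cutoff_le_one (n : ℕ) (z : X) : cutoff U n z ≤ 1 := min_le_left _ _

theorem cutoff_of_notMem (n : ℕ) {z : X} (hz : z ∉ U) : cutoff U n z = 0 := by
  simp [cutoff, Metric.infDist_zero_of_mem (show z ∈ Uᶜ from hz)]

theorem cutoff_mono (z : X) : Monotone fun n => cutoff U n z := fun _ _ h =>
  min_le_min le_rfl (mul_le_mul_of_nonneg_right (Nat.cast_le.2 h) Metric.infDist_nonneg)

theorem continuous_cutoff (n : ℕ) : Continuous (cutoff U n) :=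
  continuous_const.min (continuous_const.mul (Metric.continuous_infDist_pt _))

theorem cutoff_le_add (n : ℕ) (z w : X) : cutoff U n z ≤ cutoff U n w + n * dist w z := by
  have h : Metric.infDist z Uᶜ ≤ Metric.infDist w Uᶜ + dist w z := by
    rw [dist_comm]
    exact Metric.infDist_le_infDist_add_dist
  have h' : (n : ℝ) * Metric.infDist z Uᶜ ≤ n * Metric.infDist w Uᶜ + n * dist w z := by
    rw [← mul_add]
    gcongr
  rw [cutoff, cutoff, min_add]
  have : 0 ≤ (n : ℝ) * dist w z := by positivity
  exact le_min ((min_le_left _ _).trans (by linarith)) ((min_le_right _ _).trans h')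

theorem ofReal_cutoff_le_indicator (n : ℕ) (z : X) :
    ENNReal.ofReal (cutoff U n z) ≤ U.indicator 1 z := by
  by_cases hz : z ∈ U
  · simpa [hz] using cutoff_le_one n z
  · simp [hz, cutoff_of_notMem n hz]

/-- The complement must be nonempty: `Metric.infDist` to the empty set is `0`, so for `U = univ`
every cutoff would vanish. -/
theorem iSup_ofReal_cutoff (hU : IsOpen U) (hne : Uᶜ.Nonempty) (z : X) :
    ⨆ n, ENNReal.ofReal (cutoff U n z) = U.indicator 1 z := by
  refine le_antisymm (iSup_le fun n => ofReal_cutoff_le_indicator n z) ?_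
  by_cases hz : z ∈ U
  · have hpos : 0 < Metric.infDist z Uᶜ :=
      (hU.isClosed_compl.notMem_iff_infDist_pos hne).1 (by simpa using hz)
    obtain ⟨n, hn⟩ := exists_nat_ge (1 / Metric.infDist z Uᶜ)
    refine le_iSup_of_le n ?_
    rw [div_le_iff₀ hpos] at hn
    simp [cutoff, min_eq_left hn, hz]
  · simp [hz]

end cutoff

/-! ### From coarse curves to a curve -/

/-- If `x` and `y` are coarsely joined with uniformly bounded cost at every scale, with respect to
densities increasing to `1_U + b`, then they are joined by a curve. -/
theorem exists_curve_of_coarselyJoined {X : Type*} [MetricSpace X] [ProperSpace X] {U : Set X}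
    (hU : IsOpen U) {x y : X} (hxy : x ≠ y) (hy : y ∉ U) {b c : ℝ} (hb : 0 < b)
    (hc : 0 ≤ c)
    (h : ∀ n : ℕ, CoarselyJoined (1 / ((n : ℝ) + 1)) (fun z => cutoff U n z + b) x y c) :
    ∃ (L : ℝ) (γ : ℝ → X), 0 < L ∧ L ≤ c / b ∧ LipschitzWith 1 γ ∧ γ 0 = x ∧ γ L = y ∧
      (∀ t ∈ Ioo 0 L, γ t ≠ x ∧ γ t ≠ y) ∧
      ∫⁻ t in Icc 0 L, U.indicator 1 (γ t) ≤ ENNReal.ofReal c := by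
  set Λ := c / b with hΛ
  have hΛ0 : 0 ≤ Λ := by positivity
  choose ℓ γ hℓ h0 hend hlip hint using h
  -- The density is at least `b`, so the cost bound limits the duration.
  have hℓΛ : ∀ n, ℓ n ≤ Λ := by
    intro n
    have h1 : ENNReal.ofReal b * ENNReal.ofReal (ℓ n) ≤ ENNReal.ofReal c := by
      calc ENNReal.ofReal b * ENNReal.ofReal (ℓ n)
          = ∫⁻ t in Ico 0 (ℓ n), ENNReal.ofReal b := by
            rw [setLIntegral_const, Real.volume_Ico, sub_zero]
        _ ≤ _ := lintegral_mono fun t => ENNReal.ofReal_le_ofReal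
            (by linarith [cutoff_nonneg (U := U) n (γ n t)])
        _ ≤ _ := hint n
    rw [← ENNReal.ofReal_mul hb.le, ENNReal.ofReal_le_ofReal_iff hc] at h1
    rw [hΛ, le_div_iff₀ hb]
    linarith
  -- The cutoff index `m` is kept fixed while `n` grows. After time `ℓ n` the coarse curve rests at
  -- `y ∉ U` and contributes nothing.
  have hcut : ∀ m n, m ≤ n → ∫⁻ t in Icc 0 Λ, ENNReal.ofReal (cutoff U m (γ n t))
      ≤ ENNReal.ofReal c := by
    intro m n hmn
    have hsub : Icc 0 Λ ⊆ Ico 0 (ℓ n) ∪ Icc (ℓ n) Λ := by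
      intro t ht
      rcases lt_or_ge t (ℓ n) with h | h
      exacts [Or.inl ⟨ht.1, h⟩, Or.inr ⟨h, ht.2⟩]
    calc _ ≤ ∫⁻ t in Ico 0 (ℓ n) ∪ Icc (ℓ n) Λ, ENNReal.ofReal (cutoff U m (γ n t)) :=
          lintegral_mono_set hsub
      _ ≤ _ := lintegral_union_le _ _ _
      _ ≤ ENNReal.ofReal c + 0 := by
        refine add_le_add (le_trans (lintegral_mono fun t => ENNReal.ofReal_le_ofReal ?_)
          (hint n)) (le_of_eq ?_)
        · have := cutoff_mono (U := U) (γ n t) hmn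
          dsimp only at this
          linarith
        · rw [setLIntegral_congr_fun (g := fun _ => 0) measurableSet_Icc
            fun t ht => by simp [hend n t ht.1, cutoff_of_notMem m hy]]
          simp
      _ = _ := add_zero _
  obtain ⟨σ, hσ, hσ0, hσconst, hσlim⟩ := exists_uniform_limit_coarse
    tendsto_one_div_add_atTop_nhds_zero_nat
    (fun n => by rw [div_le_one (by positivity)]; linarith [n.cast_nonneg (α := ℝ)]) h0 hlip Λ
  -- The cutoff of index `m` is `m`-Lipschitz, so uniform closeness `ε` changes the integral by at
  -- most `m ε Λ`.
  have hcutσ : ∀ m, ∫⁻ t in Icc 0 Λ, ENNReal.ofReal (cutoff U m (σ t)) ≤ ENNReal.ofReal c := by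
    intro m
    have hε : ∀ ε > (0 : ℝ), ∫⁻ t in Icc 0 Λ, ENNReal.ofReal (cutoff U m (σ t)) ≤
        ENNReal.ofReal (c + m * ε * Λ) := by
      intro ε hε
      obtain ⟨n, hn, hnt⟩ := hσlim ε hε m
      calc _ ≤ ∫⁻ t in Icc 0 Λ, (ENNReal.ofReal (cutoff U m (γ n t)) + ENNReal.ofReal (m * ε)) := by
            refine setLIntegral_mono' measurableSet_Icc fun t ht => ?_
            rw [← ENNReal.ofReal_add (cutoff_nonneg _ _) (by positivity)]
            refine ENNReal.ofReal_le_ofReal ((cutoff_le_add m (σ t) (γ n t)).trans ?_)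
            gcongr
            exact hnt t ht
        _ = _ := lintegral_add_right _ measurable_const
        _ ≤ ENNReal.ofReal c + ENNReal.ofReal (m * ε * Λ) := by
            refine add_le_add (hcut m n hn) (le_of_eq ?_)
            rw [setLIntegral_const, Real.volume_Icc, sub_zero, ← ENNReal.ofReal_mul (by positivity)]
        _ = _ := (ENNReal.ofReal_add hc (by positivity)).symm
    have ht : Tendsto (fun ε : ℝ => ENNReal.ofReal (c + m * ε * Λ)) (𝓝[>] 0)
        (𝓝 (ENNReal.ofReal c)) := by
      have : Continuous fun ε : ℝ => ENNReal.ofReal (c + m * ε * Λ) :=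
        ENNReal.continuous_ofReal.comp (by fun_prop)
      simpa using (this.tendsto 0).mono_left (nhdsWithin_le_nhds (s := Ioi 0))
    exact ge_of_tendsto ht (eventually_mem_nhdsWithin.mono fun ε h => hε ε h)
  have hind : ∫⁻ t in Icc 0 Λ, U.indicator 1 (σ t) ≤ ENNReal.ofReal c := by
    simp_rw [← iSup_ofReal_cutoff hU ⟨y, hy⟩]
    rw [lintegral_iSup]
    · exact iSup_le hcutσ
    · intro n
      exact (ENNReal.continuous_ofReal.comp
        ((continuous_cutoff n).comp hσ.continuous)).measurable
    · intro m n hmn t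
      exact ENNReal.ofReal_le_ofReal (cutoff_mono (σ t) hmn)
  obtain ⟨s, e, hs, hse, heΛ, hsx, hey, hst⟩ := exists_first_passage hσ.continuous hxy hΛ0 hσ0
    (hσconst y Λ fun n => hend n Λ (hℓΛ n))
  refine ⟨e - s, fun t => σ (t + s), by linarith, by linarith, ?_, by simpa using hsx,
    by simpa using hey, fun t ht => hst _ ⟨by linarith [ht.1], by linarith [ht.2]⟩, ?_⟩
  · refine LipschitzWith.of_dist_le_mul fun t u => (hσ.dist_le_mul _ _).trans ?_
    simp [Real.dist_eq]
  · refine le_trans ?_ hind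
    have hmp : MeasurePreserving (fun t : ℝ => t + s) := measurePreserving_add_right volume s
    have := hmp.setLIntegral_comp_preimage_emb (measurableEmbedding_addRight s)
      (fun t => U.indicator (1 : X → ℝ≥0∞) (σ t)) (Icc s e)
    rw [preimage_add_const_Icc, sub_self] at this
    rw [this]
    exact lintegral_mono_set (Icc_subset_Icc hs heΛ)

theorem pathIntegral_indicator_le {X : Type*} [MetricSpace X] {γ : ℝ → X} {L : ℝ} {E U : Set X}
    (hγ : LipschitzOnWith 1 γ (Icc 0 L)) (h : ∀ t ∈ Ioo 0 L, γ t ∈ E → γ t ∈ U) :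
    pathIntegral γ L (E.indicator 1) ≤ ∫⁻ t in Icc 0 L, U.indicator 1 (γ t) := by
  rw [pathIntegral, ← restrict_Ioo_eq_restrict_Icc]
  refine setLIntegral_mono' measurableSet_Ioo fun t ht => ?_
  refine (mul_le_of_le_one_right' (metricDeriv_le_one hγ (Ioo_subset_Icc_self ht))).trans ?_
  by_cases hE : γ t ∈ E
  · simp [hE, h t ht hE]
  · simp [hE]

/-! ### Open enlargement of the exceptional set -/

theorem measure_ball_pos_of_doubling {X : Type*} [MetricSpace X] [MeasurableSpace X]
    {μ : Measure X} {D : ℝ} {r₀ : ℝ≥0∞} (hr₀ : 0 < r₀) (h : DoublingAtScale μ D r₀) (x : X) {r : ℝ}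
    (hr : 0 < r) : 0 < μ (Metric.ball x r) := by
  obtain ⟨q, hq, hqr⟩ := ENNReal.lt_iff_exists_nnreal_btwn.1 hr₀
  have hq0 : (0 : ℝ) < q := by simpa using hq
  have hs : 0 < min (q : ℝ) (r / 2) := lt_min hq0 (by linarith)
  refine (h x _ hs (lt_of_le_of_lt ?_ hqr)).1.trans_le (measure_mono (Metric.ball_subset_ball ?_))
  · rw [← ENNReal.ofReal_coe_nnreal]
    exact ENNReal.ofReal_le_ofReal (min_le_left _ _)
  · linarith [min_le_right (q : ℝ) (r / 2)]

/-- A Borel set is contained, apart from two given points, in an open set missing these points which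
is not much larger in measure in any ball around them. -/
theorem exists_isOpen_superset_small_at {X : Type*} [MetricSpace X] [ProperSpace X]
    [MeasurableSpace X] [BorelSpace X] (μ : Measure X) [IsLocallyFiniteMeasure μ]
    (hpos : ∀ (z : X) (s : ℝ), 0 < s → 0 < μ (Metric.ball z s)) {E : Set X} (hE : MeasurableSet E)
    (x y : X) {τ : ℝ≥0∞} (hτ : τ ≠ 0) :
    ∃ U : Set X, IsOpen U ∧ E \ {x, y} ⊆ U ∧ x ∉ U ∧ y ∉ U ∧
      ∀ z ∈ ({x, y} : Set X), ∀ s > 0,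
        μ ((U \ E) ∩ Metric.ball z s) ≤ τ * μ (Metric.ball z s) := by
  let δ : ℕ → ℝ := fun n => 1 / ((n : ℝ) + 1)
  have hδ : ∀ n, 0 < δ n := fun n => by positivity
  let O : ℕ → Set X := fun n => (Metric.closedBall x (δ n))ᶜ ∩ (Metric.closedBall y (δ n))ᶜ ∩
    Metric.ball x n
  have hO : ∀ n, IsOpen (O n) := fun n =>
    (Metric.isClosed_closedBall.isOpen_compl.inter
      Metric.isClosed_closedBall.isOpen_compl).inter Metric.isOpen_ball
  -- The open sets `O n` exhaust the complement of `{x, y}`. A ball of radius `s` about `x` or `y`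
  -- meets `O n` only if `δ n < s`, and then its measure dominates the minimum used here; the
  -- factors `2⁻¹ ^ (n + 1)` sum to `1`.
  let ε : ℕ → ℝ≥0∞ := fun n =>
    (2⁻¹ : ℝ≥0∞) ^ (n + 1) * (τ * min (μ (Metric.ball x (δ n))) (μ (Metric.ball y (δ n))))
  have hε : ∀ n, ε n ≠ 0 := by
    intro n
    refine mul_ne_zero (pow_ne_zero _ (by simp)) (mul_ne_zero hτ ?_)
    exact (lt_min (hpos x _ (hδ n)) (hpos y _ (hδ n))).ne'
  have hV : ∀ n, ∃ V ⊇ E ∩ O n, IsOpen V ∧ μ V < ∞ ∧ μ (V \ (E ∩ O n)) < ε n := fun n =>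
    (hE.inter (hO n).measurableSet).exists_isOpen_sdiff_lt
      (((measure_mono (inter_subset_right.trans inter_subset_right)).trans_lt
        measure_ball_lt_top).ne) (hε n)
  choose V hEV hVo _ hVε using hV
  refine ⟨⋃ n, V n ∩ O n, isOpen_iUnion fun n => (hVo n).inter (hO n), ?_, ?_, ?_, ?_⟩
  · rintro z ⟨hz, hzxy⟩
    simp only [mem_insert_iff, mem_singleton_iff, not_or] at hzxy
    have h1 : 0 < min (dist z x) (dist z y) := lt_min (dist_pos.2 hzxy.1) (dist_pos.2 hzxy.2)
    obtain ⟨m, hm⟩ := exists_nat_one_div_lt h1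
    obtain ⟨k, hk⟩ := exists_nat_gt (dist z x)
    have hδm : δ (max m k) ≤ 1 / ((m : ℝ) + 1) := by
      have : (m : ℝ) ≤ (max m k : ℕ) := Nat.cast_le.2 (le_max_left _ _)
      exact one_div_le_one_div_of_le (by positivity) (by linarith)
    have hzO : z ∈ O (max m k) := by
      refine ⟨⟨?_, ?_⟩, ?_⟩
      · simpa using (hδm.trans_lt hm).trans_le (min_le_left _ _)
      · simpa using (hδm.trans_lt hm).trans_le (min_le_right _ _)
      · exact hk.trans_le (Nat.cast_le.2 (le_max_right _ _))
    exact mem_iUnion.2 ⟨max m k, hEV _ ⟨hz, hzO⟩, hzO⟩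
  · simp only [mem_iUnion, not_exists]
    intro n hn
    exact hn.2.1.1 (by simpa using (hδ n).le)
  · simp only [mem_iUnion, not_exists]
    intro n hn
    exact hn.2.1.2 (by simpa using (hδ n).le)
  · intro z hz s hs
    have hn : ∀ n, μ (((V n ∩ O n) \ E) ∩ Metric.ball z s) ≤
        (2⁻¹ : ℝ≥0∞) ^ (n + 1) * (τ * μ (Metric.ball z s)) := by
      intro n
      rcases lt_or_ge (δ n) s with h | h
      · have h1 : ((V n ∩ O n) \ E) ∩ Metric.ball z s ⊆ V n \ (E ∩ O n) :=
          fun w hw => ⟨hw.1.1.1, fun h => hw.1.2 h.1⟩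
        have h2 : min (μ (Metric.ball x (δ n))) (μ (Metric.ball y (δ n))) ≤
            μ (Metric.ball z s) := by
          rcases hz with rfl | rfl
          · exact (min_le_left _ _).trans (measure_mono (Metric.ball_subset_ball h.le))
          · exact (min_le_right _ _).trans (measure_mono (Metric.ball_subset_ball h.le))
        refine (measure_mono h1).trans ((hVε n).le.trans ?_)
        dsimp only [ε]
        gcongr
      · have : ((V n ∩ O n) \ E) ∩ Metric.ball z s = ∅ := by
          refine eq_empty_of_forall_notMem fun w hw => ?_
          have hw2 : dist w z < s := hw.2
          rcases hz with rfl | rfl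
          · exact hw.1.1.2.1.1 (hw2.le.trans h)
          · exact hw.1.1.2.1.2 (hw2.le.trans h)
        simp [this]
    rw [iUnion_sdiff, iUnion_inter]
    refine (measure_iUnion_le _).trans ((ENNReal.tsum_le_tsum hn).trans ?_)
    rw [ENNReal.tsum_mul_right, ENNReal.tsum_geometric_add_one, ENNReal.one_sub_inv_two, inv_inv,
      ENNReal.inv_mul_cancel (by simp) (by simp), one_mul]

/-! ### Averages and telescoping -/

/-- Averages over comparable sets are close if the mean oscillation is small. -/
theorem enorm_average_sub_le {X : Type*} [MeasurableSpace X] {μ : Measure X} {f : X → ℝ}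
    {A B : Set X} (hAB : A ⊆ B) (hA : μ A ≠ 0) (hB : μ B ≠ ∞) {κ : ℝ≥0∞}
    (hκ : μ B ≤ κ * μ A) (hf : IntegrableOn f B μ) (c : ℝ) :
    ‖⨍ w in A, f w ∂μ - c‖ₑ ≤ κ * ⨍⁻ z in B, ‖f z - c‖ₑ ∂μ := by
  have hAt : μ A ≠ ∞ := ne_top_of_le_ne_top hB (measure_mono hAB)
  have hB0 : μ B ≠ 0 := fun h => hA (measure_mono_null hAB h)
  have h1 : ⨍ w in A, f w ∂μ - c = (μ.real A)⁻¹ • ∫ w in A, (f w - c) ∂μ := by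
    rw [setAverage_eq, integral_sub (hf.mono_set hAB) (integrableOn_const hAt), setIntegral_const,
      smul_sub, smul_smul, inv_mul_cancel₀ (by simp [Measure.real, ENNReal.toReal_eq_zero_iff, hA, hAt]),
      one_smul]
  have h2 : ‖(μ.real A)⁻¹‖ₑ = (μ A)⁻¹ := by
    rw [Real.enorm_of_nonneg (by positivity), Measure.real, ENNReal.ofReal_inv_of_pos
      (ENNReal.toReal_pos hA hAt), ENNReal.ofReal_toReal hAt]
  have h3 : (μ A)⁻¹ ≤ κ * (μ B)⁻¹ := by
    rw [← div_eq_mul_inv, ENNReal.le_div_iff_mul_le (Or.inl hB0) (Or.inl hB), mul_comm,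
      ← div_eq_mul_inv]
    exact ENNReal.div_le_of_le_mul hκ
  rw [h1, enorm_smul, h2, setLAverage_eq, div_eq_mul_inv, mul_comm (∫⁻ _ in B, _ ∂μ), ← mul_assoc]
  gcongr
  exact (enorm_integral_le_lintegral_enorm _).trans (lintegral_mono_set hAB)

theorem abs_le_of_enorm_le_ofReal {a b : ℝ} (hb : 0 ≤ b) (h : ‖a‖ₑ ≤ ENNReal.ofReal b) : |a| ≤ b := by
  rwa [Real.enorm_eq_ofReal_abs, ENNReal.ofReal_le_ofReal_iff hb] at h

section telescoping

variable {X : Type*} [MetricSpace X] [ProperSpace X] [MeasurableSpace X] [BorelSpace X]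
  {μ : Measure X} [IsLocallyFiniteMeasure μ] {f : X → ℝ}

theorem integrableOn_ball_of_continuous (hf : Continuous f) (z : X) (s : ℝ) :
    IntegrableOn f (Metric.ball z s) μ :=
  (hf.continuousOn.integrableOn_compact (isCompact_closedBall z s)).mono_set
    Metric.ball_subset_closedBall

theorem abs_average_ball_sub_self_le (hpos : ∀ (z : X) (s : ℝ), 0 < s → 0 < μ (Metric.ball z s))
    {K : NNReal} (hf : LipschitzWith K f) (z : X) {s : ℝ} (hs : 0 < s) :
    |⨍ w in Metric.ball z s, f w ∂μ - f z| ≤ K * s := by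
  refine abs_le_of_enorm_le_ofReal (by positivity) ?_
  refine (enorm_average_sub_le (κ := 1) Subset.rfl (hpos z s hs).ne' measure_ball_lt_top.ne
    (by simp) (integrableOn_ball_of_continuous hf.continuous z s) (f z)).trans ?_
  rw [one_mul, setLAverage_eq]
  refine ENNReal.div_le_of_le_mul ?_
  rw [← setLIntegral_const]
  refine setLIntegral_mono' measurableSet_ball fun w hw => ?_
  rw [Real.enorm_eq_ofReal_abs, ← Real.dist_eq]
  refine ENNReal.ofReal_le_ofReal ((hf.dist_le_mul w z).trans ?_)
  gcongr
  exact (Metric.mem_ball.1 hw).le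

/-- Telescoping over the balls `B(z, 2⁻ⁿ s₀)`. -/
theorem abs_sub_average_ball_le (hpos : ∀ (z : X) (s : ℝ), 0 < s → 0 < μ (Metric.ball z s))
    {K : NNReal} (hf : LipschitzWith K f) {z : X} {s₀ a D : ℝ} (hs₀ : 0 < s₀) (ha : 0 ≤ a)
    (hD : 0 ≤ D)
    (hosc : ∀ s ∈ Ioc 0 s₀, ⨍⁻ u in Metric.ball z s, ‖f u - ⨍ w in Metric.ball z s, f w ∂μ‖ₑ ∂μ ≤
      ENNReal.ofReal (a * s))
    (hdoub : ∀ s ∈ Ioc 0 s₀,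
      μ (Metric.ball z s) ≤ ENNReal.ofReal D * μ (Metric.ball z (s / 2))) :
    |f z - ⨍ w in Metric.ball z s₀, f w ∂μ| ≤ 2 * D * a * s₀ := by
  let A : ℕ → ℝ := fun n => ⨍ w in Metric.ball z (s₀ / 2 ^ n), f w ∂μ
  have hpow : ∀ n, s₀ / 2 ^ n ∈ Ioc 0 s₀ := fun n =>
    ⟨by positivity, div_le_self hs₀.le (one_le_pow₀ (by norm_num))⟩
  have hstep : ∀ n, |A (n + 1) - A n| ≤ D * (a * (s₀ / 2 ^ n)) := by
    intro n
    have hn := hpow n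
    have hhalf : s₀ / 2 ^ (n + 1) = s₀ / 2 ^ n / 2 := by rw [pow_succ, div_div]
    refine abs_le_of_enorm_le_ofReal (mul_nonneg hD (mul_nonneg ha hn.1.le)) ?_
    dsimp only [A]
    rw [hhalf, ENNReal.ofReal_mul hD]
    refine (enorm_average_sub_le (Metric.ball_subset_ball (by linarith [hn.1]))
      (hpos z _ (by linarith [hn.1])).ne' measure_ball_lt_top.ne (hdoub _ hn)
      (integrableOn_ball_of_continuous hf.continuous z _) _).trans ?_
    gcongr
    exact hosc _ hn
  have hsum : ∀ n, |A n - A 0| ≤ 2 * D * a * s₀ * (1 - 1 / 2 ^ n) := by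
    intro n
    induction n with
    | zero => simp
    | succ n ih =>
      have h1 := abs_sub_le (A (n + 1)) (A n) (A 0)
      have h2 : D * (a * (s₀ / 2 ^ n)) + 2 * D * a * s₀ * (1 - 1 / 2 ^ n) =
          2 * D * a * s₀ * (1 - 1 / 2 ^ (n + 1)) := by
        rw [pow_succ]
        field_simp
        ring
      linarith [hstep n]
  -- The Lipschitz constant `K` appears only in a term that tends to `0`.
  have hall : ∀ n : ℕ, |f z - A 0| ≤ K * s₀ * (1 / 2) ^ n + 2 * D * a * s₀ := by
    intro n
    have h1 := abs_sub_le (f z) (A n) (A 0)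
    have h2 : |A n - f z| ≤ K * (s₀ / 2 ^ n) :=
      abs_average_ball_sub_self_le hpos hf z (hpow n).1
    have h3 : (K : ℝ) * (s₀ / 2 ^ n) = K * s₀ * (1 / 2) ^ n := by
      rw [one_div, inv_pow]
      ring
    have h4 : 2 * D * a * s₀ * (1 - 1 / 2 ^ n) ≤ 2 * D * a * s₀ := by
      refine mul_le_of_le_one_right (by positivity) ?_
      have : (0 : ℝ) ≤ 1 / 2 ^ n := by positivity
      linarith
    rw [abs_sub_comm] at h2
    linarith [hsum n]
  have hlim : Tendsto (fun n : ℕ => (K : ℝ) * s₀ * (1 / 2) ^ n + 2 * D * a * s₀) atTop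
      (𝓝 (K * s₀ * 0 + 2 * D * a * s₀)) :=
    ((tendsto_pow_atTop_nhds_zero_of_lt_one (by norm_num) (by norm_num)).const_mul _).add_const _
  have := ge_of_tendsto' hlim hall
  simpa [A] using this

/-- The pointwise estimate for the difference of the values of a function in terms of its
mean oscillations around the two points. -/
theorem abs_sub_le_of_oscillation_le
    (hpos : ∀ (z : X) (s : ℝ), 0 < s → 0 < μ (Metric.ball z s))
    {K : NNReal} (hf : LipschitzWith K f) {x y : X} (hxy : x ≠ y) {a D : ℝ} (ha : 0 ≤ a)
    (hD : 1 ≤ D)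
    (hosc : ∀ z ∈ ({x, y} : Set X), ∀ s ∈ Ioc 0 (2 * dist x y),
      ⨍⁻ u in Metric.ball z s, ‖f u - ⨍ w in Metric.ball z s, f w ∂μ‖ₑ ∂μ ≤ ENNReal.ofReal (a * s))
    (hdoub : ∀ z ∈ ({x, y} : Set X), ∀ s ∈ Ioc 0 (4 * dist x y),
      μ (Metric.ball z s) ≤ ENNReal.ofReal D * μ (Metric.ball z (s / 2))) :
    |f x - f y| ≤ 8 * D ^ 2 * a * dist x y := by
  set r := dist x y with hr
  have hr0 : 0 < r := dist_pos.2 hxy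
  have hD0 : 0 ≤ D := by linarith
  have hxmem : x ∈ ({x, y} : Set X) := by simp
  have hymem : y ∈ ({x, y} : Set X) := by simp
  have h1 := abs_sub_average_ball_le hpos hf (z := x) (s₀ := 2 * r) (by linarith) ha hD0
    (hosc x hxmem) fun s hs => hdoub x hxmem s ⟨hs.1, by linarith [hs.2]⟩
  have h2 := abs_sub_average_ball_le hpos hf (z := y) (s₀ := r) hr0 ha hD0
    (fun s hs => hosc y hymem s ⟨hs.1, by linarith [hs.2]⟩)
    fun s hs => hdoub y hymem s ⟨hs.1, by linarith [hs.2]⟩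
  -- Here `B(y, r) ⊆ B(x, 2r) ⊆ B(y, 4r)`, so two doublings at `y` compare the balls. With `h1` and
  -- `h2` the total is `(4D + 2D + 2D²) a r ≤ 8 D² a r`.
  have h3 : |⨍ w in Metric.ball y r, f w ∂μ - ⨍ w in Metric.ball x (2 * r), f w ∂μ| ≤
      D * D * (a * (2 * r)) := by
    refine abs_le_of_enorm_le_ofReal (by positivity) ?_
    rw [ENNReal.ofReal_mul (by positivity)]
    have hκ : μ (Metric.ball x (2 * r)) ≤ ENNReal.ofReal (D * D) * μ (Metric.ball y r) := by
      have e1 := hdoub y hymem (4 * r) ⟨by linarith, le_rfl⟩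
      have e2 := hdoub y hymem (2 * r) ⟨by linarith, by linarith⟩
      rw [show 4 * r / 2 = 2 * r by ring] at e1
      rw [show 2 * r / 2 = r by ring] at e2
      calc μ (Metric.ball x (2 * r)) ≤ μ (Metric.ball y (4 * r)) :=
            measure_mono (Metric.ball_subset_ball' (by linarith))
        _ ≤ _ := e1
        _ ≤ ENNReal.ofReal D * (ENNReal.ofReal D * μ (Metric.ball y r)) := by gcongr
        _ = _ := by rw [ENNReal.ofReal_mul hD0, mul_assoc]
    refine (enorm_average_sub_le
      (Metric.ball_subset_ball' (by rw [dist_comm]; linarith)) (hpos y r hr0).ne'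
      measure_ball_lt_top.ne hκ (integrableOn_ball_of_continuous hf.continuous x _) _).trans ?_
    gcongr
    exact hosc x hxmem _ ⟨by linarith, le_rfl⟩
  have h4 : D * (a * r) ≤ D * D * (a * r) :=
    mul_le_mul_of_nonneg_right (by nlinarith) (by positivity)
  have h5 := abs_le.1 h1
  have h6 := abs_le.1 h2
  have h7 := abs_le.1 h3
  rw [abs_le]
  constructor <;> nlinarith

end telescoping

/-! ### Poincaré inequality under a density bound -/

/-- The Poincaré inequality for a function whose pointwise Lipschitz constant is at most `1_U + b`,
on balls in which `U` has small density. -/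
theorem PoincareAtScale.oscillation_le {X : Type*} [MetricSpace X] [ProperSpace X]
    [MeasurableSpace X] [BorelSpace X] {μ : Measure X} [IsLocallyFiniteMeasure μ] {p C : ℝ}
    {r₀ : ℝ≥0∞} (hp : 1 ≤ p) (hC : 1 ≤ C) (h : PoincareAtScale μ p C r₀)
    {f : X → ℝ}
    (hf : ∃ K : NNReal, LipschitzWith K f) {U : Set X} (hU : MeasurableSet U) {b : ℝ} (hb : 0 < b)
    (hfU : ∀ z, pointwiseLip f z ≤ U.indicator 1 z + ENNReal.ofReal b) {z : X} {s : ℝ} (hs : 0 < s)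
    (hsr : ENNReal.ofReal s < r₀)
    (hUs : μ (U ∩ Metric.ball z (C * s)) ≤
      2 * ENNReal.ofReal (b ^ p) * μ (Metric.ball z (C * s))) :
    ⨍⁻ u in Metric.ball z s, ‖f u - ⨍ w in Metric.ball z s, f w ∂μ‖ₑ ∂μ ≤
      ENNReal.ofReal (6 * C * b * s) := by
  have hp0 : 0 < p := by linarith
  have hCs : 0 < C * s := by positivity
  set B := Metric.ball z (C * s) with hB
  have hpt : ∀ w, pointwiseLip f w ^ p ≤
      2 ^ (p - 1) * (U.indicator 1 w + ENNReal.ofReal (b ^ p)) := by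
    intro w
    refine (ENNReal.rpow_le_rpow (hfU w) hp0.le).trans
      ((ENNReal.rpow_add_le_mul_rpow_add_rpow _ _ hp).trans (le_of_eq ?_))
    rw [ENNReal.ofReal_rpow_of_pos hb]
    by_cases hw : w ∈ U
    · simp [hw]
    · simp [hw, hp0]
  -- The factor `6` is `2 · 3`: `2` from convexity of `t ↦ t ^ p`, and `3` from the density bound `2
  -- b ^ p` plus the constant term `b ^ p`.
  have hint : ∫⁻ w in B, pointwiseLip f w ^ p ∂μ ≤
      ENNReal.ofReal (6 * b) ^ p * μ B := by
    calc _ ≤ ∫⁻ w in B, 2 ^ (p - 1) * (U.indicator 1 w + ENNReal.ofReal (b ^ p)) ∂μ :=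
          lintegral_mono hpt
      _ = 2 ^ (p - 1) * (μ (U ∩ B) + ENNReal.ofReal (b ^ p) * μ B) := by
          rw [lintegral_const_mul _ (by fun_prop (disch := assumption)),
            lintegral_add_right _ measurable_const, lintegral_indicator_one hU,
            Measure.restrict_apply hU, setLIntegral_const]
      _ ≤ 2 ^ p * (2 * ENNReal.ofReal (b ^ p) * μ B + ENNReal.ofReal (b ^ p) * μ B) := by
          gcongr
          · norm_num
          · linarith
      _ = 2 ^ p * (3 * (ENNReal.ofReal (b ^ p) * μ B)) := by ring
      _ ≤ 2 ^ p * (3 ^ p * (ENNReal.ofReal (b ^ p) * μ B)) := by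
          gcongr
          exact ENNReal.le_rpow_self_of_one_le (by norm_num) hp
      _ = _ := by
          rw [ENNReal.ofReal_mul (by norm_num), ENNReal.mul_rpow_of_nonneg _ _ hp0.le,
            ← ENNReal.ofReal_rpow_of_pos hb, show (ENNReal.ofReal 6) = 2 * 3 by norm_num,
            ENNReal.mul_rpow_of_nonneg _ _ hp0.le]
          ring
  have havg : (⨍⁻ w in B, pointwiseLip f w ^ p ∂μ) ^ (1 / p) ≤ ENNReal.ofReal (6 * b) := by
    rw [one_div, ENNReal.rpow_inv_le_iff hp0, setLAverage_eq]
    exact ENNReal.div_le_of_le_mul hint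
  refine (h f hf z s hs hsr).trans ?_
  rw [show 6 * C * b * s = C * s * (6 * b) by ring, ENNReal.ofReal_mul hCs.le]
  gcongr

theorem measure_inter_ball_le_of_maximalFunction_lt {X : Type*} [MetricSpace X]
    [ProperSpace X] [MeasurableSpace X] {μ : Measure X} [IsLocallyFiniteMeasure μ]
    {E : Set X} (hE : MeasurableSet E) {z : X} {R s : ℝ} {τ : ℝ≥0∞}
    (h : maximalFunction μ R (E.indicator 1) z < τ) (hs : s ∈ Ioo 0 R)
    (hpos : 0 < μ (Metric.ball z s)) :
    μ (E ∩ Metric.ball z s) ≤ τ * μ (Metric.ball z s) := by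
  have h1 : ⨍⁻ w in Metric.ball z s, E.indicator 1 w ∂μ ≤ τ :=
    (le_iSup₂ (f := fun r (_ : r ∈ Ioo 0 R) => ⨍⁻ w in Metric.ball z r, E.indicator 1 w ∂μ) s
      hs).trans h.le
  rw [setLAverage_eq, lintegral_indicator_one hE, Measure.restrict_apply hE] at h1
  rwa [ENNReal.div_le_iff hpos.ne' measure_ball_lt_top.ne] at h1

/-! ### Maximal connectivity -/

/-- Doubling and the Poincaré inequality imply maximal connectivity. -/
theorem maxConnectedAtScale_of_poincare {p D C : ℝ} {r₀ : ℝ≥0∞}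
    (hp : 1 ≤ p) (hD : 1 ≤ D) (hC : 1 ≤ C) (hr₀ : 0 < r₀)
    {X : Type*} [MetricSpace X] [ProperSpace X] [MeasurableSpace X] [BorelSpace X]
    {μ : Measure X} [IsLocallyFiniteMeasure μ]
    (hμ : DoublingAtScale μ D r₀) (hPI : PoincareAtScale μ p C r₀) :
    MaxConnectedAtScale μ (49 * D ^ 2 * C) (49 * D ^ 2 * C) p (r₀ / 2) := by
  intro x y hr hrr τ hτ E hE hEx hEy
  have hpos : ∀ (z : X) (s : ℝ), 0 < s → 0 < μ (Metric.ball z s) := fun z s hs =>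
    measure_ball_pos_of_doubling hr₀ hμ z hs
  have hxy : x ≠ y := dist_pos.1 hr
  set r := dist x y with hrdef
  set b := τ ^ (1 / p) with hbdef
  have hb : 0 < b := Real.rpow_pos_of_pos hτ _
  have hbp : b ^ p = τ := by
    rw [hbdef, ← Real.rpow_mul hτ.le, one_div_mul_cancel (by linarith), Real.rpow_one]
  -- Telescoping uses balls of radius up to `2r`, whence the scale `r₀ / 2`.
  have h2r : ENNReal.ofReal (2 * r) < r₀ := by
    rw [ENNReal.lt_div_iff_mul_lt (by simp) (by simp)] at hrr
    rwa [ENNReal.ofReal_mul (by norm_num), mul_comm, ENNReal.ofReal_ofNat]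
  have hD2 : 1 ≤ D ^ 2 := one_le_pow₀ hD
  -- The Poincaré inequality at radius `s ≤ 2r` needs densities up to radius `2Cr`, which must lie
  -- below the maximal function's range.
  have hC49 : 2 * C < 49 * D ^ 2 * C := by nlinarith
  obtain ⟨U, hU, hEU, hxU, hyU, hUE⟩ := exists_isOpen_superset_small_at μ hpos hE x y
    (τ := ENNReal.ofReal τ) (by simpa using hτ)
  have hUdens : ∀ z ∈ ({x, y} : Set X), ∀ s ∈ Ioo 0 (49 * D ^ 2 * C * r),
      μ (U ∩ Metric.ball z s) ≤ 2 * ENNReal.ofReal τ * μ (Metric.ball z s) := by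
    intro z hz s hs
    have hEz : maximalFunction μ (49 * D ^ 2 * C * r) (E.indicator 1) z < ENNReal.ofReal τ := by
      rcases hz with rfl | rfl
      exacts [hEx, hEy]
    calc _ ≤ μ ((E ∩ Metric.ball z s) ∪ ((U \ E) ∩ Metric.ball z s)) :=
          measure_mono fun w hw => by
            by_cases hwE : w ∈ E
            exacts [Or.inl ⟨hwE, hw.2⟩, Or.inr ⟨⟨hw.1, hwE⟩, hw.2⟩]
      _ ≤ _ := measure_union_le _ _
      _ ≤ ENNReal.ofReal τ * μ (Metric.ball z s) + ENNReal.ofReal τ * μ (Metric.ball z s) :=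
          add_le_add (measure_inter_ball_le_of_maximalFunction_lt hE hEz hs (hpos z s hs.1))
            (hUE z hz s hs.1)
      _ = _ := by ring
  -- Telescoping gives `8 D² · 6Cb · r = 48 D² C b r`; the strict excess `49` ensures that the
  -- truncation at height `c` is not what realizes the infimum at `y`.
  set c := 49 * D ^ 2 * C * b * r with hc
  have hc0 : 0 ≤ c := by positivity
  have hjoin : ∀ n : ℕ, CoarselyJoined (1 / ((n : ℝ) + 1)) (fun z => cutoff U n z + b) x y c := by
    intro n
    have hδ : 0 < 1 / ((n : ℝ) + 1) := by positivity
    have hρ : ∀ z, 0 ≤ cutoff U n z + b := fun z => add_nonneg (cutoff_nonneg n z) hb.le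
    set f := coarseDist (1 / ((n : ℝ) + 1)) (fun z => cutoff U n z + b) c x with hf
    have hfL : ∃ K, LipschitzWith K f := exists_lipschitzWith_coarseDist hδ hc0 hρ (b := 1 + b)
      fun z => by linarith [cutoff_le_one (U := U) n z]
    have hfU : ∀ z, pointwiseLip f z ≤ U.indicator 1 z + ENNReal.ofReal b := by
      intro z
      refine (pointwiseLip_coarseDist_le hδ hc0 hρ
        ((continuous_cutoff n).add continuous_const) z).trans ?_
      rw [ENNReal.ofReal_add (cutoff_nonneg n z) hb.le]
      gcongr
      exact ofReal_cutoff_le_indicator n z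
    obtain ⟨K, hK⟩ := hfL
    have hdiff := abs_sub_le_of_oscillation_le (μ := μ) hpos hK hxy (a := 6 * C * b) (D := D)
      (by positivity) hD
      (fun z hz s hs => hPI.oscillation_le hp hC ⟨K, hK⟩ hU.measurableSet hb hfU hs.1
        ((ENNReal.ofReal_le_ofReal hs.2).trans_lt h2r) (by
          rw [hbp]
          refine hUdens z hz _ ⟨by have := hs.1; positivity, ?_⟩
          calc C * s ≤ C * (2 * r) := by gcongr; exact hs.2
            _ = 2 * C * r := by ring
            _ < _ := by gcongr))
      (fun z _ s hs => by
        have := (hμ z (s / 2) (by linarith [hs.1])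
          ((ENNReal.ofReal_le_ofReal (by linarith [hs.2])).trans_lt h2r)).2
        rwa [mul_div_cancel₀ s two_ne_zero] at this)
    have hfx : f x = 0 := coarseDist_self hδ.le hc0
    rw [hfx, zero_sub, abs_neg] at hdiff
    refine exists_coarselyJoined_of_coarseDist_lt (M := c) le_rfl ?_
    refine lt_of_le_of_lt ((le_abs_self _).trans hdiff) ?_
    have : 0 < D ^ 2 * C * b * r := by positivity
    rw [hc]
    nlinarith
  obtain ⟨L, γ, hL, hLc, hγ, h0, h1, hmid, hint⟩ :=
    exists_curve_of_coarselyJoined hU hxy hyU hb hc0 hjoin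
  have hγL : LipschitzOnWith 1 γ (Icc 0 L) := hγ.lipschitzOnWith
  refine ⟨L, γ, hL, hγL, h0, h1, ?_, ?_⟩
  · refine (eVariationOn_le_of_lipschitzOnWith hγL).trans (ENNReal.ofReal_le_ofReal (hLc.trans ?_))
    rw [hc, div_le_iff₀ hb]
    exact le_of_eq (by ring)
  -- Points of `E` at interior times differ from `x` and `y`, hence lie in `U`.
  · refine (pathIntegral_indicator_le (U := U) hγL fun t ht hE => hEU ⟨hE, ?_⟩).trans hint
    simpa using hmid t ht

end MetricPI

theorem mainTheorem6 (p D C : ℝ) (r₀ : ℝ≥0∞)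
    (hp : 1 ≤ p) (hD : 1 ≤ D) (hC : 1 ≤ C) (hr₀ : 0 < r₀) :
    ∃ C₀ Δ : ℝ, 1 ≤ C₀ ∧ 0 < Δ ∧
      ∀ (X : Type*) [MetricSpace X] [ProperSpace X] [MeasurableSpace X] [BorelSpace X]
        (μ : Measure X) [IsLocallyFiniteMeasure μ],
        MetricPI.DoublingAtScale μ D r₀ →
        MetricPI.PoincareAtScale μ p C r₀ →
        MetricPI.MaxConnectedAtScale μ C₀ Δ p (r₀ / 2) := by
  have hD2 : 1 ≤ D ^ 2 := one_le_pow₀ hD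
  refine ⟨49 * D ^ 2 * C, 49 * D ^ 2 * C, by nlinarith, by positivity, ?_⟩
  intro X _ _ _ _ μ _ hμ hPI
  exact MetricPI.maxConnectedAtScale_of_poincare hp hD hC hr₀ hμ hPI
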